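/- Let $G$ be a connected, simply connected (real, finite-dimensional, smooth) Lie group with Lie algebra $\mathfrak g$, and suppose that $\dim \mathfrak g/[\mathfrak g,\mathfrak g]=n\ge 1$. Let $\Phi:G\to\mathbb R^n$ be a natural group epimorphism, i.e. a smooth surjective homomorphism onto $(\mathbb R^n,+)$ whose differential at the identity $e$ is the projection $\mathfrak g\to\mathfrak g/[\mathfrak g,\mathfrak g]$ followed by a linear isomorphism $\mathfrak g/[\mathfrak g,\mathfrak g]\cong\mathbb R^n$. Let $g$ be a left-invariant Riemannian metric on $G$ such that $\Phi:(G,g)\to\mathbb R^n$ is a Riemannian submersion onto the standard Euclidean $\mathbb R^n$. For the canonical basis $\{e_1,\dots,e_n\}$ of $\mathbb R^n$ let $\{X_1,\dots,X_n\}$ be the orthonormal basis of the horizontal space $\mathcal H_e=(\ker d\Phi_e)^\perp\subset\mathfrak g$ with $d\Phi_e(X_i)=e_i$, and put $$\xi=(\operatorname{trace}\operatorname{ad}_{X_1},\dots,\operatorname{trace}\operatorname{ad}_{X_n})\in\mathbb C^n .$$ Let $(v,w)=\sum_k v_kw_k$ be the standard symmetric complex bilinear form on $\mathbb C^n$, let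 $W$ be a maximal isotropic subspace of $\mathbb C^n$ (a subspace on which this form vanishes, maximal among these under inclusion), and put $V=\{w\in W\mid (w,\xi)=0\}$. If $\dim_{\mathbb C} V\ge 2$, then $$\Omega_V=\{\phi_v:G\to\mathbb C,\ \phi_v(x)=(\Phi(x),v)\mid v\in V\}$$ is an orthogonal family of globally defined complex-valued harmonic morphisms on $(G,g)$. That is: (a) every $\phi_v$ with $v\in V$ is smooth and satisfies $\tau(\phi_v)=0$, where $\tau$ is the Laplacian of $(G,g)$, extended complex linearly to complex-valued functions; (b) $\kappa(\phi_v,\phi_w)=g(\operatorname{grad}\phi_v,\operatorname{grad}\phi_w)=0$ on $G$ for all $v,w\in V$, where $g$ is extended complex bilinearly to the complexified tangent bundle; (c) every $\phi_v$ with $v\in V$ is a harmonic morphism: for every open $U\subset\mathbb C$ with $\phi_v^{-1}(U)\ne\emptyset$ and every harmonic function $f:U\to\mathbb R$, the function $f\circ\phi_v$ is harmonic on $\phi_v^{-1}(U)$. -/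

import Mathlib

open Bundle Set
open scoped Manifold ContDiff

noncomputable section

/-- Over `ℝ`, the smoothness exponent required by Mathlib for the Lie algebra of a Lie group is
finite, so that smooth Lie groups qualify. -/
instance minSmoothness_real_three_leInfty : ENat.LEInfty (minSmoothness ℝ 3) :=
  ⟨by
    rw [minSmoothness_of_isRCLikeNormedField]
    exact ENat.LEInfty.out⟩

/-! ### Calculus on a Riemannian manifold -/

section Riemannian

variable {E : Type*} [NormedAddCommGroup E] [NormedSpace ℝ E] [FiniteDimensional ℝ E]
  {H : Type*} [TopologicalSpace H] (I : ModelWithCorners ℝ E H)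
  {M : Type*} [TopologicalSpace M] [ChartedSpace H M] [IsManifold I ∞ M]
  [RiemannianBundle (fun x : M ↦ TangentSpace I x)]

instance finiteDimensional_tangentSpace (x : M) : FiniteDimensional ℝ (TangentSpace I x) :=
  inferInstanceAs (FiniteDimensional ℝ E)

/-- The differential `df_x`, as a continuous linear form on the tangent space at `x`. -/
def differentialForm (f : M → ℝ) (x : M) : TangentSpace I x →L[ℝ] ℝ :=
  mfderiv I 𝓘(ℝ, ℝ) f x

/-- The Riemannian gradient: the vector with `⟪grad f, v⟫ = df v` for all tangent vectors `v`. -/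
def riemGradient (f : M → ℝ) (x : M) : TangentSpace I x :=
  (InnerProductSpace.toDual ℝ (TangentSpace I x)).symm (differentialForm I f x)

/-- The divergence of a vector field `Z`, i.e. half the metric trace of the Lie derivative of the
metric along `Z`. With `E₁, …, E_m` vector fields near `x` (smooth extensions of the vectors of an
orthonormal basis of the tangent space at `x`), this is
`∑ i, (½ Z⟪E_i, E_i⟫ - ⟪[Z, E_i], E_i⟫)` at `x`; this does not depend on the basis nor on the
extensions. -/
def riemDivergence (Z : Π x : M, TangentSpace I x) (x : M) : ℝ :=
  let b := stdOrthonormalBasis ℝ (TangentSpace I x)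
  ∑ i, (
    let X : Π y : M, TangentSpace I y := FiberBundle.extend E (b i)
    (1 / 2 : ℝ) * differentialForm I (fun y ↦ inner ℝ (X y) (X y)) x (Z x)
      - inner ℝ (VectorField.mlieBracket I Z X x) (X x))

/-- The Laplace–Beltrami operator on real-valued functions: `div grad f`. -/
def riemLaplacian (f : M → ℝ) (x : M) : ℝ :=
  riemDivergence I (riemGradient I f) x

/-- A real-valued function is harmonic on a set `s` (open, in the applications) if it is `C^2`
there and its Laplacian vanishes at every point of `s`. -/
def IsRiemHarmonicOn (f : M → ℝ) (s : Set M) : Prop :=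
  ContMDiffOn I 𝓘(ℝ, ℝ) 2 f s ∧ ∀ x ∈ s, riemLaplacian I f x = 0

/-- A complex-valued harmonic morphism: a smooth map `φ : M → ℂ` that pulls back harmonic functions
on open subsets of `ℂ`, with non-empty preimage, to harmonic functions. -/
def IsHarmonicMorphism (φ : M → ℂ) : Prop :=
  ContMDiff I 𝓘(ℝ, ℂ) ∞ φ ∧
    ∀ (U : Set ℂ) (f : ℂ → ℝ), IsOpen U → (φ ⁻¹' U).Nonempty →
      InnerProductSpace.HarmonicOnNhd f U → IsRiemHarmonicOn I (f ∘ φ) (φ ⁻¹' U)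

/-- The complex-valued Laplacian `τ(φ)`. -/
def complexLaplacian (φ : M → ℂ) (x : M) : ℂ :=
  (riemLaplacian I (fun y ↦ (φ y).re) x : ℂ) +
    Complex.I * (riemLaplacian I (fun y ↦ (φ y).im) x : ℂ)

/-- `κ(φ, ψ) = g(grad φ, grad ψ)`, where `grad (a + i b) = grad a + i grad b` is a section of the
complexified tangent bundle and `g` is extended to be complex bilinear. -/
def kappa (φ ψ : M → ℂ) (x : M) : ℂ :=
  let a := riemGradient I (fun y ↦ (φ y).re) x
  let b := riemGradient I (fun y ↦ (φ y).im) x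
  let c := riemGradient I (fun y ↦ (ψ y).re) x
  let d := riemGradient I (fun y ↦ (ψ y).im) x
  ((inner ℝ a c - inner ℝ b d : ℝ) : ℂ) + Complex.I * ((inner ℝ a d + inner ℝ b c : ℝ) : ℂ)

/-- An orthogonal harmonic family: a set of smooth complex-valued functions with `τ(φ) = 0` and
`κ(φ, ψ) = 0` for all members `φ, ψ` (including `φ = ψ`). -/
def IsOrthogonalHarmonicFamily (Ω : Set (M → ℂ)) : Prop :=
  (∀ φ ∈ Ω, ContMDiff I 𝓘(ℝ, ℂ) ∞ φ ∧ ∀ x, complexLaplacian I φ x = 0) ∧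
    ∀ φ ∈ Ω, ∀ ψ ∈ Ω, ∀ x, kappa I φ ψ x = 0

/-- The differential at `x` of a map to a normed space `F`, with values in `F`. -/
def vectorDifferential {F : Type*} [NormedAddCommGroup F] [NormedSpace ℝ F] (Φ : M → F) (x : M) :
    TangentSpace I x →L[ℝ] F :=
  mfderiv I 𝓘(ℝ, F) Φ x

/-- The horizontal space at `x`: the orthogonal complement of the kernel of the differential. -/
def horizontalSpace {F : Type*} [NormedAddCommGroup F] [NormedSpace ℝ F] (Φ : M → F) (x : M) :
    Submodule ℝ (TangentSpace I x) :=
  (LinearMap.ker (vectorDifferential I Φ x).toLinearMap)ᗮ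

/-- A Riemannian submersion to a Euclidean space `F`: a smooth surjective map whose differentials
are surjective, and isometric on the horizontal spaces. -/
structure IsRiemannianSubmersion {F : Type*} [NormedAddCommGroup F] [InnerProductSpace ℝ F]
    (Φ : M → F) : Prop where
  contMDiff : ContMDiff I 𝓘(ℝ, F) ∞ Φ
  surjective : Function.Surjective Φ
  surjective_differential : ∀ x, Function.Surjective (vectorDifferential I Φ x)
  isometry_horizontal : ∀ x, ∀ v ∈ horizontalSpace I Φ x, ∀ w ∈ horizontalSpace I Φ x,
    inner ℝ (vectorDifferential I Φ x v) (vectorDifferential I Φ x w) = inner ℝ v w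

end Riemannian

/-! ### Lie groups -/

section LieGroups

variable {E : Type*} [NormedAddCommGroup E] [NormedSpace ℝ E] [FiniteDimensional ℝ E]
  {G : Type*} [TopologicalSpace G] [ChartedSpace E G] [Group G]

/-- The Riemannian metric of the Lie group `G` is left-invariant. -/
def IsLeftInvariantMetric (E : Type*) [NormedAddCommGroup E] [NormedSpace ℝ E]
    (G : Type*) [TopologicalSpace G] [ChartedSpace E G] [Group G]
    [RiemannianBundle (fun x : G ↦ TangentSpace 𝓘(ℝ, E) x)] : Prop :=
  ∀ (a x : G) (v w : TangentSpace 𝓘(ℝ, E) x),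
    inner ℝ (mfderiv 𝓘(ℝ, E) 𝓘(ℝ, E) (fun y ↦ a * y) x v)
      (mfderiv 𝓘(ℝ, E) 𝓘(ℝ, E) (fun y ↦ a * y) x w) = inner ℝ v w

/-- The abelianization `𝔤 / [𝔤, 𝔤]` of the Lie algebra `𝔤` of the Lie group `G`. -/
abbrev LieAlgebraAb (E : Type*) [NormedAddCommGroup E] [NormedSpace ℝ E] [FiniteDimensional ℝ E]
    (G : Type*) [TopologicalSpace G] [ChartedSpace E G] [Group G] [LieGroup 𝓘(ℝ, E) ∞ G] : Type _ :=
  GroupLieAlgebra 𝓘(ℝ, E) G ⧸ LieAlgebra.derivedSeries ℝ (GroupLieAlgebra 𝓘(ℝ, E) G) 1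

/-- `Φ : G → ℝⁿ` is a natural epimorphism: a smooth surjective group homomorphism to `(ℝⁿ, +)`
whose differential at the identity is the projection `𝔤 → 𝔤 / [𝔤, 𝔤]` followed by a linear
isomorphism `𝔤 / [𝔤, 𝔤] ≃ ℝⁿ`. -/
structure IsNaturalEpimorphism [LieGroup 𝓘(ℝ, E) ∞ G] {n : ℕ}
    (Φ : G → EuclideanSpace ℝ (Fin n)) : Prop where
  contMDiff : ContMDiff 𝓘(ℝ, E) 𝓘(ℝ, EuclideanSpace ℝ (Fin n)) ∞ Φ
  map_mul : ∀ x y, Φ (x * y) = Φ x + Φ y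
  surjective : Function.Surjective Φ
  differential_one : ∃ ψ : LieAlgebraAb E G ≃ₗ[ℝ] EuclideanSpace ℝ (Fin n),
    ∀ X : GroupLieAlgebra 𝓘(ℝ, E) G,
      vectorDifferential 𝓘(ℝ, E) Φ 1 X = ψ (LieSubmodule.Quotient.mk X)

end LieGroups

/-! ### Isotropic subspaces of `ℂⁿ` -/

/-- A subspace of `ℂⁿ` is isotropic if the standard symmetric bilinear form `(v, w) = ∑ v_k w_k`
vanishes on it. -/
def IsIsotropic {n : ℕ} (W : Submodule ℂ (Fin n → ℂ)) : Prop :=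
  ∀ v ∈ W, ∀ w ∈ W, v ⬝ᵥ w = 0

/-- The subspace `{w ∈ W | (w, ξ) = 0}`. -/
def annihilatedSubspace {n : ℕ} (W : Submodule ℂ (Fin n → ℂ)) (ξ : Fin n → ℂ) :
    Submodule ℂ (Fin n → ℂ) where
  carrier := {w | w ∈ W ∧ w ⬝ᵥ ξ = 0}
  zero_mem' := ⟨W.zero_mem, zero_dotProduct ξ⟩
  add_mem' := fun ha hb ↦ ⟨W.add_mem ha.1 hb.1, by rw [add_dotProduct, ha.2, hb.2, add_zero]⟩
  smul_mem' := fun c _ ha ↦ ⟨W.smul_mem c ha.1, by rw [smul_dotProduct, ha.2, smul_zero]⟩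

/-- The function `φ_v(x) = (Φ(x), v)`. -/
def phi {X : Type*} {n : ℕ} (Φ : X → EuclideanSpace ℝ (Fin n)) (v : Fin n → ℂ) (x : X) : ℂ :=
  (fun k ↦ ((Φ x k : ℝ) : ℂ)) ⬝ᵥ v

end

set_option linter.unusedSectionVars false

section LeftInvariant

variable {E : Type*} [NormedAddCommGroup E] [NormedSpace ℝ E] [FiniteDimensional ℝ E]
  {G : Type*} [TopologicalSpace G] [ChartedSpace E G] [Group G] [LieGroup 𝓘(ℝ, E) ∞ G]
  [RiemannianBundle (fun x : G ↦ TangentSpace 𝓘(ℝ, E) x)]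

theorem inner_mulInvariantVectorField (hleft : IsLeftInvariantMetric E G)
    (v w : TangentSpace 𝓘(ℝ, E) (1 : G)) (x : G) :
    inner ℝ (mulInvariantVectorField v x) (mulInvariantVectorField w x) = inner ℝ v w := by
  have cast_base : ∀ {y z : G}, y = z → ∀ a b : E,
      inner (E := TangentSpace 𝓘(ℝ, E) y) ℝ a b = inner (E := TangentSpace 𝓘(ℝ, E) z) ℝ a b := by
    rintro y _ rfl a b
    rfl
  exact (cast_base (mul_one x).symm _ _).trans (hleft x 1 v w)

/-- Left translation from the Lie algebra to the tangent space at `x`, for a left-invariant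
metric. -/
noncomputable def leftTranslation (hleft : IsLeftInvariantMetric E G) (x : G) :
    TangentSpace 𝓘(ℝ, E) (1 : G) ≃ₗᵢ[ℝ] TangentSpace 𝓘(ℝ, E) x :=
  LinearIsometry.toLinearIsometryEquiv
    (LinearMap.isometryOfInner
      { toFun := fun v ↦ mulInvariantVectorField v x
        map_add' := fun v w ↦ congrFun (mulInvariantVectorField_add v w) x
        map_smul' := fun c v ↦ congrFun (mulInvariantVectorField_smul c v) x }
      (fun v w ↦ inner_mulInvariantVectorField hleft v w x)) rfl

@[simp]
theorem leftTranslation_apply (hleft : IsLeftInvariantMetric E G) (x : G)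
    (v : TangentSpace 𝓘(ℝ, E) (1 : G)) :
    leftTranslation hleft x v = mulInvariantVectorField v x := rfl

end LeftInvariant

section SumBracket

variable {E : Type*} [NormedAddCommGroup E] [NormedSpace ℝ E] [CompleteSpace E]
  {H : Type*} [TopologicalSpace H] {I : ModelWithCorners ℝ E H}
  {M : Type*} [TopologicalSpace M] [ChartedSpace H M] [IsManifold I 2 M]

theorem mlieBracket_sum_smul_right {ι : Type*} (s : Finset ι) (h : ι → M → ℝ)
    (F : ι → Π x : M, TangentSpace I x) (Z : Π x : M, TangentSpace I x) {x : M}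
    (hh : ∀ i, MDifferentiableAt I 𝓘(ℝ, ℝ) (h i) x)
    (hF : ∀ i, MDifferentiableAt I I.tangent (fun y ↦ (F i y : TangentBundle I M)) x) :
    VectorField.mlieBracket I Z (fun y ↦ ∑ i ∈ s, h i y • F i y) x =
      ∑ i ∈ s, (mvfderiv I (h i) x (Z x) • F i x +
        h i x • VectorField.mlieBracket I Z (F i) x) := by
  classical
  induction s using Finset.induction_on with
  | empty =>
    simp only [Finset.sum_empty]
    exact congrFun (VectorField.mlieBracket_zero_right (I := I) (W := Z)) x
  | insert a s ha ih =>
    have hsplit : (fun y ↦ ∑ i ∈ insert a s, h i y • F i y) =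
        h a • F a + fun y ↦ ∑ i ∈ s, h i y • F i y := by
      funext y
      simp [Finset.sum_insert ha]
    have hs : MDifferentiableAt I I.tangent
        (fun y ↦ ((∑ i ∈ s, h i y • F i y : TangentSpace I y) : TangentBundle I M)) x :=
      .sum_section fun i _ ↦ (hh i).smul_section (hF i)
    rw [hsplit, VectorField.mlieBracket_add_right ((hh a).smul_section (hF a)) hs, ih, Finset.sum_insert ha,
      VectorField.mlieBracket_smul_right (hh a) (hF a)]

theorem mvfderiv_sum_mul_self {ι : Type*} (s : Finset ι) (h : ι → M → ℝ) {x : M}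
    (hh : ∀ i, MDifferentiableAt I 𝓘(ℝ, ℝ) (h i) x) (v : TangentSpace I x) :
    mvfderiv I (fun y ↦ ∑ i ∈ s, h i y * h i y) x v =
      2 * ∑ i ∈ s, h i x * mvfderiv I (h i) x v := by
  classical
  suffices MDifferentiableAt I 𝓘(ℝ, ℝ) (fun y ↦ ∑ i ∈ s, h i y * h i y) x ∧
      mvfderiv I (fun y ↦ ∑ i ∈ s, h i y * h i y) x v =
        2 * ∑ i ∈ s, h i x * mvfderiv I (h i) x v from this.2
  induction s using Finset.induction_on with
  | empty =>
    simp only [Finset.sum_empty, mul_zero]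
    exact ⟨mdifferentiableAt_const, by simp [mvfderiv]⟩
  | insert a s ha ih =>
    have hsplit : (fun y ↦ ∑ i ∈ insert a s, h i y * h i y) =
        h a * h a + fun y ↦ ∑ i ∈ s, h i y * h i y := by
      funext y
      simp [Finset.sum_insert ha]
    rw [hsplit]
    have hmul : MDifferentiableAt I 𝓘(ℝ, ℝ) (h a * h a) x := (hh a).mul (hh a)
    refine ⟨hmul.add ih.1, ?_⟩
    rw [mvfderiv_add hmul ih.1, mvfderiv_mul (hh a) (hh a), add_apply, ih.2,
      Finset.sum_insert ha]
    simp
    ring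

end SumBracket

section Divergence

variable {E : Type*} [NormedAddCommGroup E] [NormedSpace ℝ E] [FiniteDimensional ℝ E]
  {H : Type*} [TopologicalSpace H] {I : ModelWithCorners ℝ E H}
  {M : Type*} [TopologicalSpace M] [ChartedSpace H M] [IsManifold I ∞ M]
  [RiemannianBundle (fun x : M ↦ TangentSpace I x)]
  [IsContMDiffRiemannianBundle I ∞ E (fun x : M ↦ TangentSpace I x)]

/-- The divergence in terms of a differentiable orthonormal frame. -/
theorem riemDivergence_eq_neg_sum_inner_mlieBracket {ι : Type*} [Fintype ι]
    (F : Π x : M, OrthonormalBasis ι ℝ (TangentSpace I x))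
    (Z : Π x : M, TangentSpace I x) {x : M}
    (hF : ∀ i, MDifferentiableAt I I.tangent (fun y ↦ (F y i : TangentBundle I M)) x) :
    riemDivergence I Z x =
      -∑ i, inner ℝ (VectorField.mlieBracket I Z (fun y ↦ F y i) x) (F x i) := by
  have : CompleteSpace E := FiniteDimensional.complete ℝ E
  have : IsManifold I 2 M := IsManifold.of_le (n := ∞) (by norm_cast)
  set b := stdOrthonormalBasis ℝ (TangentSpace I x) with hb
  have key : ∀ i, (1 / 2 : ℝ) * differentialForm I (fun y ↦ inner ℝ
        (FiberBundle.extend E (b i) y : TangentSpace I y)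
        (FiberBundle.extend E (b i) y : TangentSpace I y)) x (Z x)
      - inner ℝ (VectorField.mlieBracket I Z
          (fun y ↦ (FiberBundle.extend E (b i) y : TangentSpace I y)) x)
          (FiberBundle.extend E (b i) x : TangentSpace I x) =
      -∑ j, inner ℝ (F x j) (b i) *
        inner ℝ (VectorField.mlieBracket I Z (fun y ↦ F y j) x) (b i) := by
    intro i
    set X : Π y : M, TangentSpace I y := fun y ↦ FiberBundle.extend E (b i) y with hX
    have hXx : X x = b i := FiberBundle.extend_apply_self (F := E) (b i)
    have hXd : MDifferentiableAt I I.tangent (fun y ↦ (X y : TangentBundle I M)) x :=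
      FiberBundle.mdifferentiableAt_extend I E (b i)
    let h : ι → M → ℝ := fun j y ↦ inner ℝ (F y j) (X y)
    have hh : ∀ j, MDifferentiableAt I 𝓘(ℝ, ℝ) (h j) x := fun j ↦
      MDifferentiableAt.inner_bundle (F := E) (E := fun x : M ↦ TangentSpace I x) (hF j) hXd
    have hsum : X = fun y ↦ ∑ j, h j y • F y j := by
      funext y
      exact ((F y).sum_repr' (X y)).symm
    have hnorm : (fun y ↦ inner ℝ (X y) (X y)) = fun y ↦ ∑ j, h j y * h j y := by
      funext y
      rw [← (F y).sum_inner_mul_inner]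
      exact Finset.sum_congr rfl fun j _ ↦ by rw [real_inner_comm]
    have hd : differentialForm I (fun y ↦ inner ℝ (X y) (X y)) x (Z x) =
        2 * ∑ j, h j x * mvfderiv I (h j) x (Z x) := by
      rw [hnorm]
      exact mvfderiv_sum_mul_self Finset.univ h hh (Z x)
    have hbr : VectorField.mlieBracket I Z X x = ∑ j, (mvfderiv I (h j) x (Z x) • F x j +
        h j x • VectorField.mlieBracket I Z (fun y ↦ F y j) x) := by
      conv_lhs => rw [hsum]
      exact mlieBracket_sum_smul_right Finset.univ h (fun j y ↦ F y j) Z hh hF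
    have hhx : ∀ j, inner ℝ (F x j) (b i) = h j x := fun j ↦ by simp only [h, hXx]
    change (1 / 2 : ℝ) * differentialForm I (fun y ↦ inner ℝ (X y) (X y)) x (Z x)
      - inner ℝ (VectorField.mlieBracket I Z X x) (X x) = _
    rw [hd, hbr, hXx, sum_inner, ← mul_assoc, one_div_mul_cancel two_ne_zero, one_mul,
      ← Finset.sum_sub_distrib, ← Finset.sum_neg_distrib]
    refine Finset.sum_congr rfl fun j _ ↦ ?_
    rw [inner_add_left, real_inner_smul_left, real_inner_smul_left, hhx]
    ring
  have hdef : riemDivergence I Z x = ∑ i, -∑ j, inner ℝ (F x j) (b i) *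
      inner ℝ (VectorField.mlieBracket I Z (fun y ↦ F y j) x) (b i) :=
    Finset.sum_congr rfl fun i _ ↦ key i
  rw [hdef, Finset.sum_neg_distrib, Finset.sum_comm]
  congr 1
  refine Finset.sum_congr rfl fun j _ ↦ ?_
  rw [← b.sum_inner_mul_inner]
  exact Finset.sum_congr rfl fun i _ ↦ by rw [real_inner_comm (b i) (F x j), mul_comm]

end Divergence

section LeftInvariantDivergence

variable {E : Type*} [NormedAddCommGroup E] [NormedSpace ℝ E] [FiniteDimensional ℝ E]
  {G : Type*} [TopologicalSpace G] [ChartedSpace E G] [Group G] [LieGroup 𝓘(ℝ, E) ∞ G]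
  [RiemannianBundle (fun x : G ↦ TangentSpace 𝓘(ℝ, E) x)]

theorem trace_ad_eq_sum_inner {ι : Type*} [Fintype ι]
    (b : OrthonormalBasis ι ℝ (TangentSpace 𝓘(ℝ, E) (1 : G)))
    (a : GroupLieAlgebra 𝓘(ℝ, E) G) :
    LinearMap.trace ℝ (GroupLieAlgebra 𝓘(ℝ, E) G)
      (LieAlgebra.ad ℝ (GroupLieAlgebra 𝓘(ℝ, E) G) a) =
      ∑ i, inner (E := TangentSpace 𝓘(ℝ, E) (1 : G)) ℝ
        (⁅a, (b i : GroupLieAlgebra 𝓘(ℝ, E) G)⁆) (b i) := by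
  refine (LinearMap.trace_eq_sum_inner (E := TangentSpace 𝓘(ℝ, E) (1 : G))
    (LieAlgebra.ad ℝ (GroupLieAlgebra 𝓘(ℝ, E) G) a) b).trans ?_
  exact Finset.sum_congr rfl fun i _ ↦ real_inner_comm _ _

/-- The orthonormal frame of left-invariant vector fields extending an orthonormal basis of the
Lie algebra. -/
noncomputable def leftInvariantFrame (hleft : IsLeftInvariantMetric E G) {ι : Type*} [Fintype ι]
    (b : OrthonormalBasis ι ℝ (TangentSpace 𝓘(ℝ, E) (1 : G))) (x : G) :
    OrthonormalBasis ι ℝ (TangentSpace 𝓘(ℝ, E) x) :=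
  b.map (leftTranslation hleft x)

theorem leftInvariantFrame_apply (hleft : IsLeftInvariantMetric E G) {ι : Type*} [Fintype ι]
    (b : OrthonormalBasis ι ℝ (TangentSpace 𝓘(ℝ, E) (1 : G))) (x : G) (i : ι) :
    leftInvariantFrame hleft b x i = mulInvariantVectorField (b i) x := by
  simp [leftInvariantFrame]

theorem sum_inner_mlieBracket_smul_mulInvariantVectorField (hleft : IsLeftInvariantMetric E G)
    {ι : Type*} [Fintype ι] (b : OrthonormalBasis ι ℝ (TangentSpace 𝓘(ℝ, E) (1 : G)))
    (a : GroupLieAlgebra 𝓘(ℝ, E) G) {h : G → ℝ} {x : G}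
    (hh : MDifferentiableAt 𝓘(ℝ, E) 𝓘(ℝ, ℝ) h x) :
    ∑ i, inner ℝ (VectorField.mlieBracket 𝓘(ℝ, E) (h • mulInvariantVectorField a)
        (mulInvariantVectorField (b i)) x) (mulInvariantVectorField (b i) x) =
      h x * LinearMap.trace ℝ (GroupLieAlgebra 𝓘(ℝ, E) G)
        (LieAlgebra.ad ℝ (GroupLieAlgebra 𝓘(ℝ, E) G) a) -
      mvfderiv 𝓘(ℝ, E) h x (mulInvariantVectorField a x) := by
  have : CompleteSpace E := FiniteDimensional.complete ℝ E
  have hG : LieGroup 𝓘(ℝ, E) (minSmoothness ℝ 3) G := inferInstance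
  have : IsManifold 𝓘(ℝ, E) 2 G := IsManifold.of_le (n := ∞) (by norm_cast)
  have hA := (leftInvariantFrame hleft b x).sum_repr' (mulInvariantVectorField a x)
  have hterm : ∀ i, inner ℝ (VectorField.mlieBracket 𝓘(ℝ, E) (h • mulInvariantVectorField a)
        (mulInvariantVectorField (b i)) x) (mulInvariantVectorField (b i) x) =
      h x * inner (E := TangentSpace 𝓘(ℝ, E) (1 : G)) ℝ
        (⁅a, (b i : GroupLieAlgebra 𝓘(ℝ, E) G)⁆) (b i) -
      mvfderiv 𝓘(ℝ, E) h x (inner ℝ (leftInvariantFrame hleft b x i)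
        (mulInvariantVectorField a x) • leftInvariantFrame hleft b x i) := by
    intro i
    rw [VectorField.mlieBracket_smul_left hh (mdifferentiableAt_mulInvariantVectorField a),
      ← mulInvariantVector_mlieBracket, inner_add_left, real_inner_smul_left,
      real_inner_smul_left, ← GroupLieAlgebra.bracket_def,
      inner_mulInvariantVectorField hleft ⁅a, (b i : GroupLieAlgebra 𝓘(ℝ, E) G)⁆, map_smul,
      leftInvariantFrame_apply, smul_eq_mul,
      real_inner_comm (mulInvariantVectorField a x) (mulInvariantVectorField (b i) x)]
    ring
  rw [Finset.sum_congr rfl fun i _ ↦ hterm i, Finset.sum_sub_distrib, ← Finset.mul_sum,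
    ← map_sum, hA, trace_ad_eq_sum_inner b]

theorem riemDivergence_smul_add_smul
    [IsContMDiffRiemannianBundle 𝓘(ℝ, E) ∞ E (fun x : G ↦ TangentSpace 𝓘(ℝ, E) x)]
    (hleft : IsLeftInvariantMetric E G)
    (a b : GroupLieAlgebra 𝓘(ℝ, E) G) {h k : G → ℝ} {x : G}
    (hh : MDifferentiableAt 𝓘(ℝ, E) 𝓘(ℝ, ℝ) h x) (hk : MDifferentiableAt 𝓘(ℝ, E) 𝓘(ℝ, ℝ) k x)
    {Z : Π y : G, TangentSpace 𝓘(ℝ, E) y}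
    (hZ : ∀ᶠ y in nhds x, Z y = h y • mulInvariantVectorField a y +
      k y • mulInvariantVectorField b y) :
    riemDivergence 𝓘(ℝ, E) Z x =
      mvfderiv 𝓘(ℝ, E) h x (mulInvariantVectorField a x) +
      mvfderiv 𝓘(ℝ, E) k x (mulInvariantVectorField b x) -
      (h x * LinearMap.trace ℝ (GroupLieAlgebra 𝓘(ℝ, E) G)
        (LieAlgebra.ad ℝ (GroupLieAlgebra 𝓘(ℝ, E) G) a) +
      k x * LinearMap.trace ℝ (GroupLieAlgebra 𝓘(ℝ, E) G)
        (LieAlgebra.ad ℝ (GroupLieAlgebra 𝓘(ℝ, E) G) b)) := by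
  have : CompleteSpace E := FiniteDimensional.complete ℝ E
  have hG : LieGroup 𝓘(ℝ, E) (minSmoothness ℝ 3) G := inferInstance
  have : IsManifold 𝓘(ℝ, E) 2 G := IsManifold.of_le (n := ∞) (by norm_cast)
  let e := stdOrthonormalBasis ℝ (TangentSpace 𝓘(ℝ, E) (1 : G))
  have hF : ∀ i, (fun y ↦ leftInvariantFrame hleft e y i) = mulInvariantVectorField (e i) :=
    fun i ↦ funext fun y ↦ leftInvariantFrame_apply hleft e y i
  rw [riemDivergence_eq_neg_sum_inner_mlieBracket (leftInvariantFrame hleft e) Z (x := x)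
    (fun i ↦ by
      simp only [leftInvariantFrame_apply]
      exact mdifferentiableAt_mulInvariantVectorField (e i))]
  have hterm : ∀ i, inner ℝ (VectorField.mlieBracket 𝓘(ℝ, E) Z
        (fun y ↦ leftInvariantFrame hleft e y i) x) (leftInvariantFrame hleft e x i) =
      inner ℝ (VectorField.mlieBracket 𝓘(ℝ, E) (h • mulInvariantVectorField a)
        (mulInvariantVectorField (e i)) x) (mulInvariantVectorField (e i) x) +
      inner ℝ (VectorField.mlieBracket 𝓘(ℝ, E) (k • mulInvariantVectorField b)
        (mulInvariantVectorField (e i)) x) (mulInvariantVectorField (e i) x) := by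
    intro i
    have hZ' : Z =ᶠ[nhds x] h • mulInvariantVectorField a + k • mulInvariantVectorField b := hZ
    have hbr : VectorField.mlieBracket 𝓘(ℝ, E) Z (mulInvariantVectorField (e i)) x =
        VectorField.mlieBracket 𝓘(ℝ, E) (h • mulInvariantVectorField a +
          k • mulInvariantVectorField b) (mulInvariantVectorField (e i)) x :=
      hZ'.mlieBracket_vectorField_eq Filter.EventuallyEq.rfl
    rw [hF, leftInvariantFrame_apply, hbr,
      VectorField.mlieBracket_add_left
        (hh.smul_section (mdifferentiableAt_mulInvariantVectorField a))
        (hk.smul_section (mdifferentiableAt_mulInvariantVectorField b)), inner_add_left]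
  rw [Finset.sum_congr rfl fun i _ ↦ hterm i, Finset.sum_add_distrib,
    sum_inner_mlieBracket_smul_mulInvariantVectorField hleft e a hh,
    sum_inner_mlieBracket_smul_mulInvariantVectorField hleft e b hk]
  ring

end LeftInvariantDivergence

section ChainRule

variable {E : Type*} [NormedAddCommGroup E] [NormedSpace ℝ E]
  {H : Type*} [TopologicalSpace H] {I : ModelWithCorners ℝ E H}
  {M : Type*} [TopologicalSpace M] [ChartedSpace H M]
  {F F' : Type*} [NormedAddCommGroup F] [NormedSpace ℝ F]
  [NormedAddCommGroup F'] [NormedSpace ℝ F']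

theorem mvfderiv_comp_fderiv {Φ : M → F} {Ψ : F → F'} {x : M}
    (hΨ : DifferentiableAt ℝ Ψ (Φ x)) (hΦ : MDifferentiableAt I 𝓘(ℝ, F) Φ x)
    (w : TangentSpace I x) :
    mvfderiv I (fun y ↦ Ψ (Φ y)) x w = fderiv ℝ Ψ (Φ x) (mvfderiv I Φ x w) := by
  have h := mfderiv_comp x hΨ.mdifferentiableAt hΦ
  rw [mfderiv_eq_fderiv] at h
  exact congrArg (fun T ↦ T w) h

end ChainRule

section HorizontalLift

variable {E : Type*} [NormedAddCommGroup E] [NormedSpace ℝ E] [FiniteDimensional ℝ E]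
  {G : Type*} [TopologicalSpace G] [ChartedSpace E G] [Group G] [LieGroup 𝓘(ℝ, E) ∞ G]
  {n : ℕ} {Φ : G → EuclideanSpace ℝ (Fin n)}

theorem vectorDifferential_mulInvariantVectorField
    (hΦ : MDifferentiable 𝓘(ℝ, E) 𝓘(ℝ, EuclideanSpace ℝ (Fin n)) Φ)
    (hmul : ∀ x y, Φ (x * y) = Φ x + Φ y) (x : G) (w : TangentSpace 𝓘(ℝ, E) (1 : G)) :
    vectorDifferential 𝓘(ℝ, E) Φ x (mulInvariantVectorField w x) =
      vectorDifferential 𝓘(ℝ, E) Φ 1 w := by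
  have hL : MDifferentiableAt 𝓘(ℝ, E) 𝓘(ℝ, E) (fun y : G ↦ x * y) 1 :=
    (contMDiff_mul_left (I := 𝓘(ℝ, E)) (n := ∞)).mdifferentiableAt (by simp)
  have hcomp := mfderiv_comp_of_eq (hΦ x) hL (mul_one x)
  have hadd : Φ ∘ (fun y ↦ x * y) = fun y ↦ Φ x + Φ y := funext fun y ↦ hmul x y
  have hsum : mvfderiv 𝓘(ℝ, E) (fun y ↦ Φ x + Φ y) 1 = mvfderiv 𝓘(ℝ, E) Φ 1 := by
    rw [mvfderiv_fun_add mdifferentiableAt_const (hΦ 1), mvfderiv_const, zero_add]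
  rw [hadd] at hcomp
  have cast_base : ∀ {y z : G}, y = z → ∀ a : E,
      vectorDifferential 𝓘(ℝ, E) Φ y a = vectorDifferential 𝓘(ℝ, E) Φ z a := by
    rintro y _ rfl a
    rfl
  exact (cast_base (mul_one x).symm _).trans
    ((congrArg (fun T ↦ T w) hcomp).symm.trans (congrArg (fun T ↦ T w) hsum))

variable [RiemannianBundle (fun x : G ↦ TangentSpace 𝓘(ℝ, E) x)]

theorem inner_horizontal_lift (hsub : IsRiemannianSubmersion 𝓘(ℝ, E) Φ) {x : G}
    {X : TangentSpace 𝓘(ℝ, E) x} (hX : X ∈ horizontalSpace 𝓘(ℝ, E) Φ x)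
    (w : TangentSpace 𝓘(ℝ, E) x) :
    inner ℝ X w = inner ℝ (vectorDifferential 𝓘(ℝ, E) Φ x X)
      (vectorDifferential 𝓘(ℝ, E) Φ x w) := by
  obtain ⟨k, hk, h, hh, rfl⟩ := Submodule.exists_add_mem_mem_orthogonal
    (K := LinearMap.ker (vectorDifferential 𝓘(ℝ, E) Φ x).toLinearMap) w
  have hk0 : vectorDifferential 𝓘(ℝ, E) Φ x k = 0 := hk
  rw [inner_add_right, map_add, hk0, zero_add, hsub.isometry_horizontal x X hX h hh,
    real_inner_comm, hX k hk, zero_add]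

/-- The vector `∑ u_k X_k`. -/
noncomputable def horizontalLift (X : Fin n → TangentSpace 𝓘(ℝ, E) (1 : G))
    (u : EuclideanSpace ℝ (Fin n)) : TangentSpace 𝓘(ℝ, E) (1 : G) :=
  ∑ k, u k • X k

variable {X : Fin n → TangentSpace 𝓘(ℝ, E) (1 : G)}

theorem vectorDifferential_horizontalLift
    (hX_lift : ∀ i, vectorDifferential 𝓘(ℝ, E) Φ 1 (X i) = EuclideanSpace.single i 1)
    (u : EuclideanSpace ℝ (Fin n)) :
    vectorDifferential 𝓘(ℝ, E) Φ 1 (horizontalLift X u) = u := by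
  ext i
  simp [horizontalLift, hX_lift, Finset.sum_apply, Pi.single_apply]

theorem inner_horizontalLift (hsub : IsRiemannianSubmersion 𝓘(ℝ, E) Φ)
    (hX_hor : ∀ i, X i ∈ horizontalSpace 𝓘(ℝ, E) Φ 1)
    (hX_lift : ∀ i, vectorDifferential 𝓘(ℝ, E) Φ 1 (X i) = EuclideanSpace.single i 1)
    (u : EuclideanSpace ℝ (Fin n)) (w : TangentSpace 𝓘(ℝ, E) (1 : G)) :
    inner ℝ (horizontalLift X u) w = inner ℝ u (vectorDifferential 𝓘(ℝ, E) Φ 1 w) := by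
  have hmem : horizontalLift X u ∈ horizontalSpace 𝓘(ℝ, E) Φ 1 :=
    Submodule.sum_mem _ fun k _ ↦ Submodule.smul_mem _ _ (hX_hor k)
  rw [inner_horizontal_lift hsub hmem, vectorDifferential_horizontalLift hX_lift]

/-- The gradient of a function of the form `Ψ ∘ Φ`. -/
theorem riemGradient_comp (hleft : IsLeftInvariantMetric E G)
    (hmul : ∀ x y, Φ (x * y) = Φ x + Φ y) (hsub : IsRiemannianSubmersion 𝓘(ℝ, E) Φ)
    (hX_hor : ∀ i, X i ∈ horizontalSpace 𝓘(ℝ, E) Φ 1)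
    (hX_lift : ∀ i, vectorDifferential 𝓘(ℝ, E) Φ 1 (X i) = EuclideanSpace.single i 1)
    {Ψ : EuclideanSpace ℝ (Fin n) → ℝ} {x : G} (hΨ : DifferentiableAt ℝ Ψ (Φ x))
    {u : EuclideanSpace ℝ (Fin n)} (hu : ∀ w, fderiv ℝ Ψ (Φ x) w = inner ℝ u w) :
    riemGradient 𝓘(ℝ, E) (fun y ↦ Ψ (Φ y)) x =
      mulInvariantVectorField (horizontalLift X u) x := by
  have hΦ : MDifferentiable 𝓘(ℝ, E) 𝓘(ℝ, EuclideanSpace ℝ (Fin n)) Φ :=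
    hsub.contMDiff.mdifferentiable (by simp)
  rw [riemGradient, LinearIsometryEquiv.symm_apply_eq]
  ext w
  obtain ⟨w', rfl⟩ := (leftTranslation hleft x).surjective w
  rw [InnerProductSpace.toDual_apply_apply, leftTranslation_apply,
    inner_mulInvariantVectorField hleft, inner_horizontalLift hsub hX_hor hX_lift,
    ← vectorDifferential_mulInvariantVectorField hΦ hmul x, ← hu]
  exact mvfderiv_comp_fderiv hΨ (hΦ x) _

end HorizontalLift

section ComplexForms

variable {n : ℕ}

/-- The real-linear map `z ↦ ⟪a, z⟫ + ⟪b, z⟫ i`. -/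
noncomputable def complexForm (a b : EuclideanSpace ℝ (Fin n)) : EuclideanSpace ℝ (Fin n) →L[ℝ] ℂ :=
  Complex.equivRealProdCLM.symm.toContinuousLinearMap.comp ((innerSL ℝ a).prod (innerSL ℝ b))

theorem complexForm_re (a b z : EuclideanSpace ℝ (Fin n)) :
    (complexForm a b z).re = inner ℝ a z := by
  simp [complexForm]

theorem complexForm_im (a b z : EuclideanSpace ℝ (Fin n)) :
    (complexForm a b z).im = inner ℝ b z := by
  simp [complexForm]

theorem complexForm_eq (a b z : EuclideanSpace ℝ (Fin n)) :
    complexForm a b z = (inner ℝ a z : ℝ) • (1 : ℂ) + (inner ℝ b z : ℝ) • Complex.I := by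
  apply Complex.ext <;> simp [complexForm_re, complexForm_im]

/-- The componentwise real part of a complex vector. -/
noncomputable def rePart (v : Fin n → ℂ) : EuclideanSpace ℝ (Fin n) :=
  WithLp.toLp 2 fun k ↦ (v k).re

/-- The componentwise imaginary part of a complex vector. -/
noncomputable def imPart (v : Fin n → ℂ) : EuclideanSpace ℝ (Fin n) :=
  WithLp.toLp 2 fun k ↦ (v k).im

theorem phi_eq_complexForm {X : Type*} (Φ : X → EuclideanSpace ℝ (Fin n)) (v : Fin n → ℂ) (x : X) :
    phi Φ v x = complexForm (rePart v) (imPart v) (Φ x) := by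
  apply Complex.ext <;>
    simp [complexForm_re, complexForm_im, phi, dotProduct, PiLp.inner_apply, rePart, imPart]

theorem dotProduct_eq_inner (v w : Fin n → ℂ) :
    v ⬝ᵥ w = ((inner ℝ (rePart v) (rePart w) - inner ℝ (imPart v) (imPart w) : ℝ) : ℂ) +
      Complex.I * ((inner ℝ (rePart v) (imPart w) + inner ℝ (imPart v) (rePart w) : ℝ) : ℂ) := by
  apply Complex.ext <;>
    simp [dotProduct, PiLp.inner_apply, rePart, imPart, Finset.sum_sub_distrib,
      Finset.sum_add_distrib, mul_comm]

theorem fderiv_fderiv_apply_eq_zero_of_harmonicAt {f : ℂ → ℝ} {z : ℂ}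
    (hf : InnerProductSpace.HarmonicAt f z) :
    fderiv ℝ (fderiv ℝ f) z 1 1 + fderiv ℝ (fderiv ℝ f) z Complex.I Complex.I = 0 := by
  have h := hf.2.self_of_nhds
  rw [InnerProductSpace.laplacian_eq_iteratedFDeriv_complexPlane] at h
  simpa [iteratedFDeriv_two_apply] using h

end ComplexForms

theorem trace_ad_sum_smul {L : Type*} [LieRing L] [LieAlgebra ℝ L] {ι : Type*} (s : Finset ι)
    (u : ι → ℝ) (X : ι → L) :
    LinearMap.trace ℝ L (LieAlgebra.ad ℝ L (∑ k ∈ s, u k • X k)) =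
      ∑ k ∈ s, u k * LinearMap.trace ℝ L (LieAlgebra.ad ℝ L (X k)) := by
  simp only [map_sum, map_smul, smul_eq_mul]

section Laplacian

variable {E : Type*} [NormedAddCommGroup E] [NormedSpace ℝ E] [FiniteDimensional ℝ E]
  {G : Type*} [TopologicalSpace G] [ChartedSpace E G] [Group G] [LieGroup 𝓘(ℝ, E) ∞ G]
  [RiemannianBundle (fun x : G ↦ TangentSpace 𝓘(ℝ, E) x)]
  {n : ℕ} {Φ : G → EuclideanSpace ℝ (Fin n)} {X : Fin n → TangentSpace 𝓘(ℝ, E) (1 : G)}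

theorem horizontalLift_add_smul (r s : ℝ) (a b : EuclideanSpace ℝ (Fin n)) :
    horizontalLift X (r • a + s • b) = r • horizontalLift X a + s • horizontalLift X b := by
  simp only [horizontalLift, Finset.smul_sum, ← Finset.sum_add_distrib]
  exact Finset.sum_congr rfl fun k _ ↦ by simp [add_smul, mul_smul]

theorem trace_ad_horizontalLift (u : EuclideanSpace ℝ (Fin n)) :
    LinearMap.trace ℝ (GroupLieAlgebra 𝓘(ℝ, E) G)
      (LieAlgebra.ad ℝ (GroupLieAlgebra 𝓘(ℝ, E) G) (horizontalLift X u)) =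
    ∑ k, u k * LinearMap.trace ℝ (GroupLieAlgebra 𝓘(ℝ, E) G)
      (LieAlgebra.ad ℝ (GroupLieAlgebra 𝓘(ℝ, E) G) (X k)) :=
  trace_ad_sum_smul (L := GroupLieAlgebra 𝓘(ℝ, E) G) Finset.univ u X

theorem riemGradient_inner (hleft : IsLeftInvariantMetric E G)
    (hmul : ∀ x y, Φ (x * y) = Φ x + Φ y) (hsub : IsRiemannianSubmersion 𝓘(ℝ, E) Φ)
    (hX_hor : ∀ i, X i ∈ horizontalSpace 𝓘(ℝ, E) Φ 1)
    (hX_lift : ∀ i, vectorDifferential 𝓘(ℝ, E) Φ 1 (X i) = EuclideanSpace.single i 1)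
    (u : EuclideanSpace ℝ (Fin n)) :
    riemGradient 𝓘(ℝ, E) (fun y ↦ inner ℝ u (Φ y)) =
      mulInvariantVectorField (horizontalLift X u) := by
  funext x
  refine riemGradient_comp hleft hmul hsub hX_hor hX_lift (Ψ := fun z ↦ inner ℝ u z)
    (innerSL ℝ u).differentiableAt fun w ↦ ?_
  exact congrArg (fun T ↦ T w) (innerSL ℝ u).fderiv

theorem inner_riemGradient_inner (hleft : IsLeftInvariantMetric E G)
    (hmul : ∀ x y, Φ (x * y) = Φ x + Φ y) (hsub : IsRiemannianSubmersion 𝓘(ℝ, E) Φ)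
    (hX_hor : ∀ i, X i ∈ horizontalSpace 𝓘(ℝ, E) Φ 1)
    (hX_lift : ∀ i, vectorDifferential 𝓘(ℝ, E) Φ 1 (X i) = EuclideanSpace.single i 1)
    (u w : EuclideanSpace ℝ (Fin n)) (x : G) :
    inner ℝ (riemGradient 𝓘(ℝ, E) (fun y ↦ inner ℝ u (Φ y)) x)
      (riemGradient 𝓘(ℝ, E) (fun y ↦ inner ℝ w (Φ y)) x) = inner ℝ u w := by
  rw [riemGradient_inner hleft hmul hsub hX_hor hX_lift,
    riemGradient_inner hleft hmul hsub hX_hor hX_lift, inner_mulInvariantVectorField hleft,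
    inner_horizontalLift hsub hX_hor hX_lift, vectorDifferential_horizontalLift hX_lift]

variable [IsContMDiffRiemannianBundle 𝓘(ℝ, E) ∞ E (fun x : G ↦ TangentSpace 𝓘(ℝ, E) x)]

theorem riemLaplacian_inner (hleft : IsLeftInvariantMetric E G)
    (hmul : ∀ x y, Φ (x * y) = Φ x + Φ y) (hsub : IsRiemannianSubmersion 𝓘(ℝ, E) Φ)
    (hX_hor : ∀ i, X i ∈ horizontalSpace 𝓘(ℝ, E) Φ 1)
    (hX_lift : ∀ i, vectorDifferential 𝓘(ℝ, E) Φ 1 (X i) = EuclideanSpace.single i 1)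
    (u : EuclideanSpace ℝ (Fin n)) (x : G) :
    riemLaplacian 𝓘(ℝ, E) (fun y ↦ inner ℝ u (Φ y)) x =
      -LinearMap.trace ℝ (GroupLieAlgebra 𝓘(ℝ, E) G)
        (LieAlgebra.ad ℝ (GroupLieAlgebra 𝓘(ℝ, E) G) (horizontalLift X u)) := by
  rw [riemLaplacian, riemGradient_inner hleft hmul hsub hX_hor hX_lift,
    riemDivergence_smul_add_smul hleft (horizontalLift X u) 0 (h := fun _ ↦ 1) (k := fun _ ↦ 0)
      mdifferentiableAt_const mdifferentiableAt_const (Filter.Eventually.of_forall fun y ↦ by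
        rw [one_smul, zero_smul, add_zero])]
  simp [mvfderiv_const]

/-- The composition of a harmonic function with a horizontally conformal complex form of `Φ` that
is itself harmonic. -/
theorem riemLaplacian_comp_complexForm_eq_zero (hleft : IsLeftInvariantMetric E G)
    (hmul : ∀ x y, Φ (x * y) = Φ x + Φ y) (hsub : IsRiemannianSubmersion 𝓘(ℝ, E) Φ)
    (hX_hor : ∀ i, X i ∈ horizontalSpace 𝓘(ℝ, E) Φ 1)
    (hX_lift : ∀ i, vectorDifferential 𝓘(ℝ, E) Φ 1 (X i) = EuclideanSpace.single i 1)
    {a b : EuclideanSpace ℝ (Fin n)} (hab : inner ℝ a b = (0 : ℝ))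
    (hnorm : (inner ℝ a a : ℝ) = inner ℝ b b)
    (ha : LinearMap.trace ℝ (GroupLieAlgebra 𝓘(ℝ, E) G)
      (LieAlgebra.ad ℝ (GroupLieAlgebra 𝓘(ℝ, E) G) (horizontalLift X a)) = 0)
    (hb : LinearMap.trace ℝ (GroupLieAlgebra 𝓘(ℝ, E) G)
      (LieAlgebra.ad ℝ (GroupLieAlgebra 𝓘(ℝ, E) G) (horizontalLift X b)) = 0)
    {f : ℂ → ℝ} {x : G} (hf : InnerProductSpace.HarmonicAt f (complexForm a b (Φ x))) :
    riemLaplacian 𝓘(ℝ, E) (fun y ↦ f (complexForm a b (Φ y))) x = 0 := by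
  have hΦ : MDifferentiable 𝓘(ℝ, E) 𝓘(ℝ, EuclideanSpace ℝ (Fin n)) Φ :=
    hsub.contMDiff.mdifferentiable (by simp)
  set L := complexForm a b with hL
  have hf' : DifferentiableAt ℝ (fderiv ℝ f) (L (Φ x)) :=
    (hf.1.fderiv_right (m := 1) (by norm_num)).differentiableAt one_ne_zero
  have hpartial : ∀ c : ℂ, HasFDerivAt (fun z ↦ fderiv ℝ f (L z) c)
      (((fderiv ℝ (fderiv ℝ f) (L (Φ x))).comp L).flip c) (Φ x) := fun c ↦ by
    have := (hf'.hasFDerivAt.comp (Φ x) L.hasFDerivAt).clm_apply (hasFDerivAt_const c (Φ x))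
    simpa using this
  have hmd : ∀ c : ℂ, MDifferentiableAt 𝓘(ℝ, E) 𝓘(ℝ, ℝ) (fun y ↦ fderiv ℝ f (L (Φ y)) c) x :=
    fun c ↦ (hpartial c).differentiableAt.mdifferentiableAt.comp x (hΦ x)
  have hd : ∀ (c : ℂ) (u : EuclideanSpace ℝ (Fin n)),
      mvfderiv 𝓘(ℝ, E) (fun y ↦ fderiv ℝ f (L (Φ y)) c) x
        (mulInvariantVectorField (horizontalLift X u) x) =
      fderiv ℝ (fderiv ℝ f) (L (Φ x)) (L u) c := by
    intro c u
    have hu : mvfderiv 𝓘(ℝ, E) Φ x (mulInvariantVectorField (horizontalLift X u) x) = u :=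
      (vectorDifferential_mulInvariantVectorField hΦ hmul x _).trans
        (vectorDifferential_horizontalLift hX_lift u)
    rw [mvfderiv_comp_fderiv (Ψ := fun z ↦ fderiv ℝ f (L z) c) (hpartial c).differentiableAt
      (hΦ x), hu, (hpartial c).fderiv]
    rfl
  have hcont : ContinuousAt (fun y ↦ L (Φ y)) x :=
    L.continuous.continuousAt.comp (hΦ x).continuousAt
  have hgrad : ∀ᶠ y in nhds x, riemGradient 𝓘(ℝ, E) (fun y ↦ f (L (Φ y))) y =
      fderiv ℝ f (L (Φ y)) 1 • mulInvariantVectorField (horizontalLift X a) y +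
        fderiv ℝ f (L (Φ y)) Complex.I • mulInvariantVectorField (horizontalLift X b) y := by
    filter_upwards [hcont.eventually hf.eventually] with y hy
    have hfy : DifferentiableAt ℝ f (L (Φ y)) := hy.1.differentiableAt two_ne_zero
    rw [riemGradient_comp hleft hmul hsub hX_hor hX_lift (Ψ := fun z ↦ f (L z))
      (u := fderiv ℝ f (L (Φ y)) 1 • a + fderiv ℝ f (L (Φ y)) Complex.I • b)
      (hfy.comp _ L.differentiableAt) fun w ↦ ?_, horizontalLift_add_smul,
      mulInvariantVectorField_add, mulInvariantVectorField_smul, mulInvariantVectorField_smul]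
    · rfl
    · have hcomp : fderiv ℝ (fun z ↦ f (L z)) (Φ y) = (fderiv ℝ f (L (Φ y))).comp L :=
        (hfy.hasFDerivAt.comp (Φ y) L.hasFDerivAt).fderiv
      rw [hcomp]
      simp only [ContinuousLinearMap.comp_apply, hL, complexForm_eq a b w, map_add, map_smul,
        inner_add_left, real_inner_smul_left, smul_eq_mul]
      ring
  rw [riemLaplacian, riemDivergence_smul_add_smul hleft _ _ (hmd 1) (hmd Complex.I) hgrad, hd, hd,
    ha, hb, hL, complexForm_eq a b a, complexForm_eq a b b, real_inner_comm a b, hab, ← hnorm, ← hL]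
  simp only [zero_smul, add_zero, zero_add, mul_zero, sub_zero, map_smul,
    smul_apply, ← smul_add, fderiv_fderiv_apply_eq_zero_of_harmonicAt hf,
    smul_zero]

end Laplacian

theorem mainTheorem1
    {E : Type*} [NormedAddCommGroup E] [NormedSpace ℝ E] [FiniteDimensional ℝ E]
    {G : Type*} [TopologicalSpace G] [ChartedSpace E G] [Group G] [LieGroup 𝓘(ℝ, E) ∞ G]
    [ConnectedSpace G] [SimplyConnectedSpace G]
    [RiemannianBundle (fun x : G ↦ TangentSpace 𝓘(ℝ, E) x)]
    [IsContMDiffRiemannianBundle 𝓘(ℝ, E) ∞ E (fun x : G ↦ TangentSpace 𝓘(ℝ, E) x)]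
    (hleft : IsLeftInvariantMetric E G)
    (n : ℕ) (hn : 1 ≤ n) (hdim : Module.finrank ℝ (LieAlgebraAb E G) = n)
    (Φ : G → EuclideanSpace ℝ (Fin n)) (hΦ : IsNaturalEpimorphism (E := E) Φ)
    (hsub : IsRiemannianSubmersion 𝓘(ℝ, E) Φ)
    (X : Fin n → GroupLieAlgebra 𝓘(ℝ, E) G)
    (hX_hor : ∀ i, X i ∈ horizontalSpace 𝓘(ℝ, E) Φ 1)
    (hX_lift : ∀ i, vectorDifferential 𝓘(ℝ, E) Φ 1 (X i) = EuclideanSpace.single i 1)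
    (ξ : Fin n → ℂ)
    (hξ : ξ = fun i ↦ ((LinearMap.trace ℝ (GroupLieAlgebra 𝓘(ℝ, E) G)
      (LieAlgebra.ad ℝ (GroupLieAlgebra 𝓘(ℝ, E) G) (X i)) : ℝ) : ℂ))
    (W : Submodule ℂ (Fin n → ℂ)) (hW : Maximal IsIsotropic W)
    (hV : 2 ≤ Module.finrank ℂ (annihilatedSubspace W ξ)) :
    IsOrthogonalHarmonicFamily 𝓘(ℝ, E) {φ | ∃ v ∈ annihilatedSubspace W ξ, φ = phi Φ v} ∧
      ∀ v ∈ annihilatedSubspace W ξ, IsHarmonicMorphism 𝓘(ℝ, E) (phi Φ v) := by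
  have hmul := hΦ.map_mul
  have hφ : ∀ v, phi Φ v = fun y ↦ complexForm (rePart v) (imPart v) (Φ y) :=
    fun v ↦ funext (phi_eq_complexForm Φ v)
  have hre : ∀ v, (fun y ↦ (phi Φ v y).re) = fun y ↦ inner ℝ (rePart v) (Φ y) := fun v ↦ by
    simp only [hφ, complexForm_re]
  have him : ∀ v, (fun y ↦ (phi Φ v y).im) = fun y ↦ inner ℝ (imPart v) (Φ y) := fun v ↦ by
    simp only [hφ, complexForm_im]
  have hsmooth : ∀ v, ContMDiff 𝓘(ℝ, E) 𝓘(ℝ, ℂ) ∞ (phi Φ v) := fun v ↦ by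
    rw [hφ]
    exact (complexForm (rePart v) (imPart v)).contDiff.contMDiff.comp hsub.contMDiff
  have hdot : ∀ v w : Fin n → ℂ, v ⬝ᵥ w = 0 →
      (inner ℝ (rePart v) (rePart w) : ℝ) - inner ℝ (imPart v) (imPart w) = 0 ∧
      (inner ℝ (rePart v) (imPart w) : ℝ) + inner ℝ (imPart v) (rePart w) = 0 := by
    intro v w h
    rw [dotProduct_eq_inner] at h
    exact ⟨by simpa using congrArg Complex.re h, by simpa using congrArg Complex.im h⟩
  have htrace : ∀ v ∈ annihilatedSubspace W ξ,
      LinearMap.trace ℝ (GroupLieAlgebra 𝓘(ℝ, E) G)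
        (LieAlgebra.ad ℝ (GroupLieAlgebra 𝓘(ℝ, E) G) (horizontalLift X (rePart v))) = 0 ∧
      LinearMap.trace ℝ (GroupLieAlgebra 𝓘(ℝ, E) G)
        (LieAlgebra.ad ℝ (GroupLieAlgebra 𝓘(ℝ, E) G) (horizontalLift X (imPart v))) = 0 := by
    intro v hv
    have h : v ⬝ᵥ ξ = 0 := hv.2
    rw [hξ] at h
    rw [trace_ad_horizontalLift, trace_ad_horizontalLift]
    exact ⟨by simpa [dotProduct, rePart] using congrArg Complex.re h,
      by simpa [dotProduct, imPart] using congrArg Complex.im h⟩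
  refine ⟨⟨?_, ?_⟩, fun v hv ↦ ⟨hsmooth v, fun U f hU _ hf ↦ ⟨?_, fun x hx ↦ ?_⟩⟩⟩
  · rintro _ ⟨v, hv, rfl⟩
    refine ⟨hsmooth v, fun x ↦ ?_⟩
    rw [complexLaplacian, hre, him, riemLaplacian_inner hleft hmul hsub hX_hor hX_lift,
      riemLaplacian_inner hleft hmul hsub hX_hor hX_lift, (htrace v hv).1, (htrace v hv).2]
    simp
  · rintro _ ⟨v, hv, rfl⟩ _ ⟨w, hw, rfl⟩ x
    simp only [kappa, hre, him, inner_riemGradient_inner hleft hmul hsub hX_hor hX_lift]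
    rw [← dotProduct_eq_inner]
    exact hW.prop v hv.1 w hw.1
  · exact hf.contDiffOn.contMDiffOn.comp ((hsmooth v).of_le (by norm_cast)).contMDiffOn
      fun x hx ↦ hx
  · obtain ⟨h₁, h₂⟩ := hdot v v (hW.prop v hv.1 v hv.1)
    rw [real_inner_comm (rePart v) (imPart v)] at h₂
    have hfx := hf _ hx
    rw [hφ] at hfx ⊢
    exact riemLaplacian_comp_complexForm_eq_zero hleft hmul hsub hX_hor hX_lift
      (by linarith) (by linarith) (htrace v hv).1 (htrace v hv).2 hfx
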